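/- Let $k$ be an algebraically closed field and let $\mathcal H$ be a hereditary category over $k$, that is, a connected abelian $k$-linear category in which $\mathrm{Ext}^2_{\mathcal H}(X,Y)=0$ and in which $\mathrm{Hom}_{\mathcal H}(X,Y)$ and $\mathrm{Ext}^1_{\mathcal H}(X,Y)$ are finite dimensional over $k$, for all $X,Y\in\mathcal H$. Full subcategories are understood to be closed under isomorphisms. Identify $\mathcal H$ with the full subcategory of complexes concentrated in degree $0$ of the bounded derived category $\mathcal D^b(\mathcal H)$, and for a full subcategory $\mathcal U$ of $\mathcal D^b(\mathcal H)$ put $\mathcal U^\perp=\{Y \mid \mathrm{Hom}(X,Y)=0 \text{ for all } X\in\mathcal U\}$. A torsion pair in $\mathcal H$ is a pair $(\mathcal T,\mathcal F)$ of full subcategories of $\mathcal H$ such that $\mathrm{Hom}_{\mathcal H}(X,Y)=0$ for all $X\in\mathcal T$, $Y\in\mathcal F$, and such that every $Y\in\mathcal H$ has a short exact sequence $0\to X\to Y\to Z\to 0$ with $X\in\mathcal T$, $Z\in\mathcal F$. Every t-structure in $\mathcal D^b(\mathcal H)$ has the form $(\mathcal U,\mathcal U^\perp[1])$, where $\mathcal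 U$ is its aisle. Then the following two maps are well defined, and they are mutually inverse bijections between the class of all torsion pairs $(\mathcal T,\mathcal F)$ in $\mathcal H$ and the class of all t-structures $(\mathcal U,\mathcal U^\perp[1])$ in $\mathcal D^b(\mathcal H)$ such that $\mathcal H[1]\subseteq\mathcal U$ and $\mathcal H[-1]\subseteq\mathcal U^\perp$: - the lift map, sending $(\mathcal T,\mathcal F)$ to the t-structure $(\mathcal U_{\mathcal T},\mathcal U_{\mathcal T}^\perp[1])$ with $$\mathcal U_{\mathcal T}=\{X \mid H^i(X)=0 \text{ for all } i>0,\ H^0(X)\in\mathcal T\},\qquad \mathcal U_{\mathcal T}^\perp[1]=\{X \mid H^i(X)=0 \text{ for all } i<-1,\ H^{-1}(X)\in\mathcal F\};$$ - the trace map, sending $(\mathcal U,\mathcal U^\perp[1])$ to the torsion pair $(\mathcal U\cap\mathcal H,\ \mathcal U^\perp\cap\mathcal H)$. -/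

import Mathlib

open CategoryTheory CategoryTheory.Limits CategoryTheory.Triangulated

universe w' w v u t

namespace TorsionTilt

/-- An additive category is connected if it is not the direct sum of two nonzero full
subcategories: whenever `P` and `Q` are classes of objects without nonzero morphisms between
them, in either direction, such that every object is a direct sum of an object of `P` and an
object of `Q`, one of the two classes consists of zero objects only. -/
def IsConnectedAdditive (H : Type u) [Category.{v} H] [Abelian H] : Prop :=
  ∀ P Q : ObjectProperty H,
    (∀ X Y : H, P X → Q Y → ∀ f : X ⟶ Y, f = 0) →
    (∀ X Y : H, P X → Q Y → ∀ f : Y ⟶ X, f = 0) →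
    (∀ Z : H, ∃ X Y : H, P X ∧ Q Y ∧ Nonempty (Z ≅ X ⊞ Y)) →
    (∀ X : H, P X → IsZero X) ∨ (∀ Y : H, Q Y → IsZero Y)

/-- A hereditary category over `k`: a connected abelian `k`-linear category in which `Ext²`
vanishes and in which the spaces `Hom` and `Ext¹` are finite dimensional. -/
structure IsHereditary (k : Type t) [Field k] (H : Type u) [Category.{v} H] [Abelian H]
    [Linear k H] [HasExt.{w'} H] : Prop where
  connected : IsConnectedAdditive H
  ext_two_eq_zero : ∀ (X Y : H) (e : Abelian.Ext.{w'} X Y 2), e = 0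
  finite_hom : ∀ X Y : H, Module.Finite k (X ⟶ Y)
  finite_ext_one : ∀ X Y : H, Module.Finite k (Abelian.Ext.{w'} X Y 1)

/-- A torsion pair `(𝒯, ℱ)` in an abelian category. Full subcategories are given by classes of
objects that are closed under isomorphisms. -/
@[ext]
structure TorsionPair (H : Type u) [Category.{v} H] [Abelian H] where
  /-- the torsion objects -/
  torsion : ObjectProperty H
  /-- the torsion-free objects -/
  torsionFree : ObjectProperty H
  torsion_of_iso : torsion.IsClosedUnderIsomorphisms
  torsionFree_of_iso : torsionFree.IsClosedUnderIsomorphisms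
  hom_eq_zero : ∀ ⦃X Y : H⦄, torsion X → torsionFree Y → ∀ f : X ⟶ Y, f = 0
  exists_shortExact : ∀ Y : H, ∃ (X Z : H) (f : X ⟶ Y) (g : Y ⟶ Z) (zero : f ≫ g = 0),
    torsion X ∧ torsionFree Z ∧ (ShortComplex.mk f g zero).ShortExact

variable {H : Type u} [Category.{v} H] [Abelian H] [HasDerivedCategory.{w} H]

/-- An object `M` of `H`, seen in the bounded derived category as a complex concentrated in
degree `0`. -/
noncomputable def stalk (M : H) : DerivedCategory.Bounded H :=
  ⟨(DerivedCategory.singleFunctor H 0).obj M, ⟨0, inferInstance⟩, ⟨0, inferInstance⟩⟩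

/-- The cohomology object `Hⁱ(X)` of an object `X` of the bounded derived category. -/
noncomputable def coho (i : ℤ) (X : DerivedCategory.Bounded H) : H :=
  (DerivedCategory.homologyFunctor H i).obj X.obj

/-- The objects `X` with `Hⁱ(X) = 0` for `i > 0` and `H⁰(X) ∈ 𝒯`. -/
def liftAisle (τ : TorsionPair H) : ObjectProperty (DerivedCategory.Bounded H) :=
  fun X => (∀ i : ℤ, 0 < i → IsZero (coho i X)) ∧ τ.torsion (coho 0 X)

/-- The objects `X` with `Hⁱ(X) = 0` for `i < -1` and `H⁻¹(X) ∈ ℱ`. -/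
def liftCoaisle (τ : TorsionPair H) : ObjectProperty (DerivedCategory.Bounded H) :=
  fun X => (∀ i : ℤ, i < -1 → IsZero (coho i X)) ∧ τ.torsionFree (coho (-1) X)

/-- The t-structure `s`, that is, the pair `(𝒰, 𝒱) = (s.le 0, s.ge 0)`, is the lift of the
torsion pair `τ`. -/
structure IsLift (τ : TorsionPair H) (s : TStructure (DerivedCategory.Bounded H)) : Prop where
  le_zero_eq : s.le 0 = liftAisle τ
  ge_zero_eq : s.ge 0 = liftCoaisle τ

/-- The torsion pair `τ` is the trace `(𝒰 ∩ H, 𝒰^⊥ ∩ H)` of the t-structure `s`, where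
`𝒰 = s.le 0`. -/
structure IsTrace (s : TStructure (DerivedCategory.Bounded H)) (τ : TorsionPair H) : Prop where
  torsion_iff : ∀ M : H, τ.torsion M ↔ s.le 0 (stalk M)
  torsionFree_iff : ∀ M : H, τ.torsionFree M ↔ (s.le 0).rightOrthogonal (stalk M)

/-- The conditions `H[1] ⊆ 𝒰` and `H[-1] ⊆ 𝒰^⊥` on a t-structure with aisle `𝒰 = s.le 0`. -/
structure IsIntermediate (s : TStructure (DerivedCategory.Bounded H)) : Prop where
  shift_one_mem : ∀ M : H, s.le 0 ((stalk M)⟦(1 : ℤ)⟧)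
  shift_neg_one_mem : ∀ M : H, (s.le 0).rightOrthogonal ((stalk M)⟦(-1 : ℤ)⟧)

end TorsionTilt

/-!
Write `𝒰 ⋆ 𝒱` for the class of extensions of objects of `𝒱` by objects of `𝒰`; octahedra
show that this operation is associative. Since `Dᵇ(H) = D^{≤ -1} ⋆ H ⋆ D^{≥ 1}`, and `H = 𝒯 ⋆ ℱ`
for a torsion pair, `Dᵇ(H) = (D^{≤ -1} ⋆ 𝒯) ⋆ (ℱ ⋆ D^{≥ 1})`. The two factors are orthogonal,
because orthogonals are closed under extensions, so they are the aisle and the orthogonal of the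
aisle of a t-structure, the lift of `(𝒯, ℱ)`.

Conversely, if `H[1] ⊆ 𝒰` and `H[-1] ⊆ 𝒰^⊥`, then `D^{≤ -1} ⊆ 𝒰` and `D^{≥ 1} ⊆ 𝒰^⊥` by dévissage
along the truncations of a bounded complex. Hence the truncation triangle of an object of `H` with
respect to `𝒰` has all its vertices in `H`, that is, it is a short exact sequence of `H`.

The two constructions are inverse to each other, because two t-structures (or torsion pairs)
coincide as soon as both parts of the one are contained in the corresponding parts of the other.
-/

open Pretriangulated ObjectProperty ZeroObject

namespace TorsionTilt

section TStructure

variable {C : Type*} [Category* C] [Preadditive C] [HasZeroObject C] [HasShift C ℤ]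
  [∀ n : ℤ, (shiftFunctor C n).Additive] [Pretriangulated C] (s t : TStructure C)

lemma rightOrthogonal_le (n₀ n₁ : ℤ) (h : n₀ + 1 = n₁) :
    (t.le n₀).rightOrthogonal = t.ge n₁ := by
  ext Y
  rw [t.ge_iff_isGE, t.isGE_iff_orthogonal n₀ n₁ h, rightOrthogonal_iff]
  exact ⟨fun hY X f hX => hY f hX.le, fun hY X f hX => hY X f ⟨hX⟩⟩

lemma leftOrthogonal_ge (n₀ n₁ : ℤ) (h : n₀ + 1 = n₁) :
    (t.ge n₁).leftOrthogonal = t.le n₀ := by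
  ext X
  rw [t.le_iff_isLE, t.isLE_iff_orthogonal n₀ n₁ h, leftOrthogonal_iff]
  exact ⟨fun hX Y f hY => hX f hY.ge, fun hX Y f hY => hX Y f ⟨hY⟩⟩

instance (n : ℤ) : (t.le n).IsTriangulatedClosed₂ := by
  rw [← leftOrthogonal_ge t n _ rfl]
  infer_instance

instance (n : ℤ) : (t.ge n).IsTriangulatedClosed₂ := by
  rw [← rightOrthogonal_le t _ n (sub_add_cancel n 1)]
  infer_instance

instance (n : ℤ) : (t.le n).ContainsZero := by
  rw [← leftOrthogonal_ge t n _ rfl]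
  infer_instance

instance (n : ℤ) : (t.ge n).ContainsZero := by
  rw [← rightOrthogonal_le t _ n (sub_add_cancel n 1)]
  infer_instance

lemma isGE_obj₁ {T : Triangle C} (hT : T ∈ distTriang C) (n₀ n₁ : ℤ) (h : n₀ + 1 = n₁)
    (h₂ : t.IsGE T.obj₂ n₁) (h₃ : t.IsGE T.obj₃ n₀) : t.IsGE T.obj₁ n₁ :=
  t.isGE₂ _ (inv_rot_of_distTriang _ hT) n₁ (t.isGE_shift T.obj₃ n₀ (-1) n₁) h₂

lemma isLE_obj₃ {T : Triangle C} (hT : T ∈ distTriang C) (n₀ n₁ : ℤ) (h : n₀ + 1 = n₁)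
    (h₂ : t.IsLE T.obj₂ n₀) (h₁ : t.IsLE T.obj₁ n₁) : t.IsLE T.obj₃ n₀ :=
  t.isLE₂ _ (rot_of_distTriang _ hT) n₀ h₂ (t.isLE_shift T.obj₁ n₁ 1 n₀)

lemma le_zero_le_extensionProduct :
    t.le 0 ≤ (t.le (-1)).extensionProduct t.heart := by
  intro X hX
  obtain ⟨A, B, hA, hB, f, g, h, hT⟩ := t.exists_triangle X (-1) 0 rfl
  have hB' : t.IsLE B 0 := isLE_obj₃ t hT 0 1 rfl ⟨hX⟩ ⟨t.le_monotone (by lia) _ hA⟩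
  exact ⟨A, B, f, g, h, hT, hA, hB'.le, hB⟩

lemma ge_zero_le_extensionProduct :
    t.ge 0 ≤ t.heart.extensionProduct (t.ge 1) := by
  intro X hX
  obtain ⟨A, B, hA, hB, f, g, h, hT⟩ := t.exists_triangle X 0 1 rfl
  have hA' : t.IsGE A 0 := isGE_obj₁ t hT (-1) 0 rfl ⟨hX⟩ ⟨t.ge_antitone (by lia) _ hB⟩
  exact ⟨A, B, f, g, h, hT, ⟨hA, hA'.ge⟩, hB⟩

lemma extensionProduct_le_ge (n₀ n₁ : ℤ) (h : n₀ + 1 = n₁) :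
    (t.le n₀).extensionProduct (t.ge n₁) = ⊤ := by
  refine top_unique fun X _ => ?_
  obtain ⟨A, B, hA, hB, f, g, h, hT⟩ := t.exists_triangle X n₀ n₁ h
  exact ⟨A, B, f, g, h, hT, hA, hB⟩

variable {s t}

lemma le_le_le_of_ge_le_ge {m n : ℤ} (h : t.ge (m + 1) ≤ s.ge (n + 1)) : s.le n ≤ t.le m := by
  rw [← leftOrthogonal_ge s n _ rfl, ← leftOrthogonal_ge t m _ rfl]
  exact fun X hX Y f hY => hX f (h _ hY)

lemma ge_le_ge_of_le_le_le {m n : ℤ} (h : t.le m ≤ s.le n) : s.ge (n + 1) ≤ t.ge (m + 1) := by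
  rw [← rightOrthogonal_le s n _ rfl, ← rightOrthogonal_le t m _ rfl]
  exact fun Y hY X f hX => hY f (h _ hX)

lemma le_le_le_of_sub_eq {m n m' n' : ℤ} (h : t.le m ≤ s.le n) (hmn : m' - m = n' - n) :
    t.le m' ≤ s.le n' := by
  rw [← t.shift_le (m' - m) m m' (by lia), ← s.shift_le (m' - m) n n' (by lia)]
  exact fun X hX => h _ hX

lemma ge_le_ge_of_sub_eq {m n m' n' : ℤ} (h : t.ge m ≤ s.ge n) (hmn : m' - m = n' - n) :
    t.ge m' ≤ s.ge n' := by
  rw [← t.shift_ge (m' - m) m m' (by lia), ← s.shift_ge (m' - m) n n' (by lia)]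
  exact fun X hX => h _ hX

lemma tStructure_eq_of_le_of_ge (hle : s.le 0 ≤ t.le 0) (hge : s.ge 1 ≤ t.ge 1) : s = t := by
  have hle' : t.le 0 ≤ s.le 0 := le_le_le_of_ge_le_ge hge
  have le_eq : s.le = t.le := funext fun n =>
    le_antisymm (le_le_le_of_sub_eq hle rfl) (le_le_le_of_sub_eq hle' rfl)
  have ge_eq : s.ge = t.ge := funext fun n => by
    rw [← rightOrthogonal_le s _ n (sub_add_cancel n 1),
      ← rightOrthogonal_le t _ n (sub_add_cancel n 1), le_eq]
  cases s
  cases t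
  cases le_eq
  cases ge_eq
  rfl

lemma le_inf_ge_le_of_forall_mem_Icc (R : ObjectProperty C) [R.IsTriangulatedClosed₂]
    [R.IsClosedUnderIsomorphisms] {a b : ℤ} (hab : a ≤ b)
    (hR : ∀ n ∈ Set.Icc a b, t.le n ⊓ t.ge n ≤ R) : t.le b ⊓ t.ge a ≤ R := by
  intro X hX
  induction b, hab using Int.leInduction generalizing X with
  | base => exact hR a (by simp) X hX
  | succ b hab ih =>
    obtain ⟨A, B, hA, hB, f, g, h, hT⟩ := t.exists_triangle X b (b + 1) rfl
    have hA' : t.IsGE A a :=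
      isGE_obj₁ t hT (a - 1) a (by lia) ⟨hX.2⟩ ⟨t.ge_antitone (by lia) _ hB⟩
    have hB' : t.IsLE B (b + 1) :=
      isLE_obj₃ t hT (b + 1) (b + 2) (by lia) ⟨hX.1⟩ ⟨t.le_monotone (by lia) _ hA⟩
    exact R.ext_of_isTriangulatedClosed₂ _ hT
      (ih (fun n hn => hR n ⟨hn.1, hn.2.trans (by lia)⟩) A ⟨hA, hA'.ge⟩)
      (hR (b + 1) ⟨by lia, le_rfl⟩ B ⟨hB'.le, hB⟩)

lemma heart_shift (n : ℤ) : t.heart.shift n = t.le n ⊓ t.ge n := by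
  rw [← t.shift_le n 0 n (add_zero n), ← t.shift_ge n 0 n (add_zero n)]
  rfl

lemma le_zero_le_of_heart_le {n : ℤ} (ht : t.plus = ⊤) (h : t.heart ≤ s.le n) :
    t.le 0 ≤ s.le n := by
  intro X hX
  obtain ⟨m, hm⟩ : t.plus X := ht ▸ trivial
  refine le_inf_ge_le_of_forall_mem_Icc (s.le n) (min_le_right m 0) (fun i hi Y hY => ?_) X
    ⟨hX, t.ge_antitone (min_le_left m 0) _ hm.ge⟩
  rw [← heart_shift] at hY
  have : s.IsLE (Y⟦i⟧) n := ⟨h _ hY⟩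
  exact s.le_monotone (by have := hi.2; lia) _ (s.isLE_of_shift Y (i + n) i n).le

lemma ge_zero_le_of_heart_le {n : ℤ} (ht : t.minus = ⊤) (h : t.heart ≤ s.ge n) :
    t.ge 0 ≤ s.ge n := by
  intro X hX
  obtain ⟨m, hm⟩ : t.minus X := ht ▸ trivial
  refine le_inf_ge_le_of_forall_mem_Icc (s.ge n) (le_max_right m 0) (fun i hi Y hY => ?_) X
    ⟨t.le_monotone (le_max_left m 0) _ hm.le, hX⟩
  rw [← heart_shift] at hY
  have : s.IsGE (Y⟦i⟧) n := ⟨h _ hY⟩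
  exact s.ge_antitone (by have := hi.1; lia) _ (s.isGE_of_shift Y (i + n) i n).ge

/-- The t-structure with `le 0 = U` and `ge 1 = V`, provided that these two classes are orthogonal
and that every object is an extension of an object of `V` by an object of `U`. -/
def tStructureOfExtensionProduct (U V : ObjectProperty C) [U.IsClosedUnderIsomorphisms]
    [V.IsClosedUnderIsomorphisms] [U.IsStableUnderShiftBy (1 : ℤ)]
    [V.IsStableUnderShiftBy (-1 : ℤ)] (hUV : U ≤ V.leftOrthogonal)
    (htop : U.extensionProduct V = ⊤) : TStructure C where
  le n := U.shift n
  ge n := V.shift (n - 1)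
  le_shift n a n' h X hX := by
    rwa [← U.shift_shift a n' n h] at hX
  ge_shift n a n' h X hX := by
    rwa [← V.shift_shift a (n' - 1) (n - 1) (by lia)] at hX
  zero' X Y f hX hY := by
    rw [U.shift_zero] at hX
    rw [sub_self, V.shift_zero] at hY
    exact hUV _ hX f hY
  le_zero_le := by
    rw [U.shift_zero]
    exact U.le_shift 1
  ge_one_le := by
    rw [sub_self, V.shift_zero]
    exact V.le_shift (-1)
  exists_triangle_zero_one A := by
    rw [U.shift_zero, sub_self, V.shift_zero]
    obtain ⟨X, Y, f, g, h, hT, hX, hY⟩ : U.extensionProduct V A := htop ▸ trivial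
    exact ⟨X, Y, hX, hY, f, g, h, hT⟩

section

variable {U V : ObjectProperty C} [U.IsClosedUnderIsomorphisms]
  [V.IsClosedUnderIsomorphisms] [U.IsStableUnderShiftBy (1 : ℤ)]
  [V.IsStableUnderShiftBy (-1 : ℤ)] (hUV : U ≤ V.leftOrthogonal)
  (htop : U.extensionProduct V = ⊤)

lemma tStructureOfExtensionProduct_le_zero :
    (tStructureOfExtensionProduct U V hUV htop).le 0 = U :=
  U.shift_zero ℤ

lemma tStructureOfExtensionProduct_ge_one :
    (tStructureOfExtensionProduct U V hUV htop).ge 1 = V :=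
  V.shift_zero ℤ

end

variable (t) in
/-- The classes `P` and `Q` form a torsion pair in the heart of `t`; the short exact sequences of
the heart are encoded by the distinguished triangles of `C` with all three vertices in the heart. -/
structure IsHeartTorsionPair (P Q : ObjectProperty C) : Prop where
  left_le_heart : P ≤ t.heart
  right_le_heart : Q ≤ t.heart
  le_leftOrthogonal : P ≤ Q.leftOrthogonal
  heart_le_extensionProduct : t.heart ≤ P.extensionProduct Q

namespace IsHeartTorsionPair

variable {P Q : ObjectProperty C}

lemma containsZero_left (h : IsHeartTorsionPair t P Q) : P.ContainsZero := by
  obtain ⟨A, B, f, g, δ, hT, hA, hB⟩ :=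
    h.heart_le_extensionProduct 0 ⟨(t.le 0).prop_zero, (t.ge 0).prop_zero⟩
  have hA' : t.IsGE A 1 :=
    isGE_obj₁ t hT 0 1 rfl ⟨(t.ge 1).prop_zero⟩ ⟨(h.right_le_heart B hB).2⟩
  have : t.IsLE A 0 := ⟨(h.left_le_heart A hA).1⟩
  exact ⟨A, t.isZero A 0 1, hA⟩

lemma containsZero_right (h : IsHeartTorsionPair t P Q) : Q.ContainsZero := by
  obtain ⟨A, B, f, g, δ, hT, hA, hB⟩ :=
    h.heart_le_extensionProduct 0 ⟨(t.le 0).prop_zero, (t.ge 0).prop_zero⟩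
  have hB' : t.IsLE B (-1) :=
    isLE_obj₃ t hT (-1) 0 rfl ⟨(t.le (-1)).prop_zero⟩ ⟨(h.left_le_heart A hA).1⟩
  have : t.IsGE B 0 := ⟨(h.right_le_heart B hB).2⟩
  exact ⟨B, t.isZero B (-1) 0, hB⟩

lemma aisle_le_le_zero (h : IsHeartTorsionPair t P Q) :
    (t.le (-1)).extensionProduct P ≤ t.le 0 :=
  extensionProduct_le_of_isTriangulatedClosed₂ (t.le_monotone (by lia))
    (h.left_le_heart.trans inf_le_left)

lemma coaisle_le_ge_zero (h : IsHeartTorsionPair t P Q) :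
    Q.extensionProduct (t.ge 1) ≤ t.ge 0 :=
  extensionProduct_le_of_isTriangulatedClosed₂ (h.right_le_heart.trans inf_le_right)
    (t.ge_antitone (by lia))

lemma le_neg_one_le_aisle (h : IsHeartTorsionPair t P Q) :
    t.le (-1) ≤ (t.le (-1)).extensionProduct P :=
  have := h.containsZero_left
  le_extensionProduct_left _

lemma ge_one_le_coaisle (h : IsHeartTorsionPair t P Q) :
    t.ge 1 ≤ Q.extensionProduct (t.ge 1) :=
  have := h.containsZero_right
  le_extensionProduct_right _

lemma isStableUnderShiftBy_aisle (h : IsHeartTorsionPair t P Q) :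
    ((t.le (-1)).extensionProduct P).IsStableUnderShiftBy (1 : ℤ) where
  le_shift X hX :=
    h.le_neg_one_le_aisle _ (t.le_shift 0 1 (-1) rfl X (h.aisle_le_le_zero X hX))

lemma isStableUnderShiftBy_coaisle (h : IsHeartTorsionPair t P Q) :
    (Q.extensionProduct (t.ge 1)).IsStableUnderShiftBy (-1 : ℤ) where
  le_shift X hX :=
    h.ge_one_le_coaisle _ (t.ge_shift 0 (-1) 1 rfl X (h.coaisle_le_ge_zero X hX))

lemma coaisle_le_rightOrthogonal_left (h : IsHeartTorsionPair t P Q) :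
    Q.extensionProduct (t.ge 1) ≤ P.rightOrthogonal :=
  extensionProduct_le_of_isTriangulatedClosed₂
    (fun _ hY _ f hX => h.le_leftOrthogonal _ hX f hY)
    (fun _ hY _ f hX => t.zero' f (h.left_le_heart _ hX).1 hY)

lemma aisle_le_leftOrthogonal_coaisle (h : IsHeartTorsionPair t P Q) :
    (t.le (-1)).extensionProduct P ≤ (Q.extensionProduct (t.ge 1)).leftOrthogonal :=
  extensionProduct_le_of_isTriangulatedClosed₂
    (fun _ hX _ f hY => t.zero_of_isLE_of_isGE f (-1) 0 (by lia) ⟨hX⟩ ⟨h.coaisle_le_ge_zero _ hY⟩)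
    (fun _ hX _ f hY => h.coaisle_le_rightOrthogonal_left _ hY f hX)

lemma aisle_extensionProduct_coaisle [IsTriangulated C] (h : IsHeartTorsionPair t P Q) :
    ((t.le (-1)).extensionProduct P).extensionProduct (Q.extensionProduct (t.ge 1)) = ⊤ := by
  refine top_unique ?_
  calc ⊤ = (t.le (-1)).extensionProduct (t.ge 0) := (extensionProduct_le_ge t (-1) 0 rfl).symm
    _ ≤ (t.le (-1)).extensionProduct (t.heart.extensionProduct (t.ge 1)) :=
        monotone_extensionProduct_right _ (ge_zero_le_extensionProduct t)
    _ ≤ (t.le (-1)).extensionProduct ((P.extensionProduct Q).extensionProduct (t.ge 1)) :=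
        monotone_extensionProduct_right _
          (monotone_extensionProduct_left _ h.heart_le_extensionProduct)
    _ = _ := by simp only [extensionProduct_assoc]

/-- The tilt of `t` at a torsion pair `(P, Q)` in its heart (Happel–Reiten–Smalø): the t-structure
with aisle `t.le (-1) ⋆ P` and with `ge 1 = Q ⋆ t.ge 1`. -/
def tilt [IsTriangulated C] (h : IsHeartTorsionPair t P Q) : TStructure C :=
  have := h.isStableUnderShiftBy_aisle
  have := h.isStableUnderShiftBy_coaisle
  tStructureOfExtensionProduct _ _ h.aisle_le_leftOrthogonal_coaisle
    h.aisle_extensionProduct_coaisle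

variable [IsTriangulated C]

lemma tilt_le_zero (h : IsHeartTorsionPair t P Q) :
    h.tilt.le 0 = (t.le (-1)).extensionProduct P :=
  have := h.isStableUnderShiftBy_aisle
  have := h.isStableUnderShiftBy_coaisle
  tStructureOfExtensionProduct_le_zero h.aisle_le_leftOrthogonal_coaisle
    h.aisle_extensionProduct_coaisle

lemma tilt_ge_one (h : IsHeartTorsionPair t P Q) :
    h.tilt.ge 1 = Q.extensionProduct (t.ge 1) :=
  have := h.isStableUnderShiftBy_aisle
  have := h.isStableUnderShiftBy_coaisle
  tStructureOfExtensionProduct_ge_one h.aisle_le_leftOrthogonal_coaisle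
    h.aisle_extensionProduct_coaisle

lemma heart_le_tilt_le_one (h : IsHeartTorsionPair t P Q) : t.heart ≤ h.tilt.le 1 := by
  have : t.le (-1) ≤ h.tilt.le 0 := h.tilt_le_zero ▸ h.le_neg_one_le_aisle
  exact inf_le_left.trans (le_le_le_of_sub_eq this rfl)

lemma heart_le_tilt_ge_zero (h : IsHeartTorsionPair t P Q) : t.heart ≤ h.tilt.ge 0 := by
  have : t.ge 1 ≤ h.tilt.ge 1 := h.tilt_ge_one ▸ h.ge_one_le_coaisle
  exact inf_le_right.trans (ge_le_ge_of_sub_eq this rfl)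

lemma left_le_tilt_le_zero (h : IsHeartTorsionPair t P Q) : P ≤ h.tilt.le 0 :=
  h.tilt_le_zero ▸ le_extensionProduct_right _

lemma right_le_tilt_ge_one (h : IsHeartTorsionPair t P Q) : Q ≤ h.tilt.ge 1 :=
  h.tilt_ge_one ▸ le_extensionProduct_left _

end IsHeartTorsionPair

section

variable (ht : t.bounded = ⊤)

include ht

lemma le_neg_one_le_of_heart_le (hs : t.heart ≤ s.le 1) : t.le (-1) ≤ s.le 0 :=
  le_le_le_of_sub_eq (le_zero_le_of_heart_le (inf_eq_top_iff.1 ht).1 hs) rfl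

lemma ge_one_le_of_heart_le (hs : t.heart ≤ s.ge 0) : t.ge 1 ≤ s.ge 1 :=
  ge_le_ge_of_sub_eq (ge_zero_le_of_heart_le (inf_eq_top_iff.1 ht).2 hs) rfl

lemma heart_le_extensionProduct_of_heart_le (hle : t.heart ≤ s.le 1) (hge : t.heart ≤ s.ge 0) :
    t.heart ≤ (t.heart ⊓ s.le 0).extensionProduct (t.heart ⊓ s.ge 1) := by
  intro X hX
  have le_le : s.le 0 ≤ t.le 0 := le_le_le_of_ge_le_ge (ge_one_le_of_heart_le ht hge)
  have ge_le : s.ge 1 ≤ t.ge 0 := ge_le_ge_of_le_le_le (le_neg_one_le_of_heart_le ht hle)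
  obtain ⟨A, B, hA, hB, f, g, δ, hT⟩ := s.exists_triangle X 0 1 rfl
  have hA' : t.IsGE A 0 := isGE_obj₁ t hT (-1) 0 rfl ⟨hX.2⟩ ⟨t.ge_antitone (by lia) _ (ge_le _ hB)⟩
  have hB' : t.IsLE B 0 := isLE_obj₃ t hT 0 1 rfl ⟨hX.1⟩ ⟨t.le_monotone (by lia) _ (le_le _ hA)⟩
  exact ⟨A, B, f, g, δ, hT, ⟨⟨le_le _ hA, hA'.ge⟩, hA⟩, ⟨⟨hB'.le, ge_le _ hB⟩, hB⟩⟩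

lemma isHeartTorsionPair_trace (hle : t.heart ≤ s.le 1) (hge : t.heart ≤ s.ge 0) :
    IsHeartTorsionPair t (t.heart ⊓ s.le 0) (t.heart ⊓ s.ge 1) where
  left_le_heart := inf_le_left
  right_le_heart := inf_le_left
  le_leftOrthogonal _ hX _ f hY := s.zero' f hX.2 hY.2
  heart_le_extensionProduct := heart_le_extensionProduct_of_heart_le ht hle hge

lemma tilt_eq_of_le_of_le [IsTriangulated C] (hle : t.heart ≤ s.le 1) (hge : t.heart ≤ s.ge 0)
    {P Q : ObjectProperty C} (h : IsHeartTorsionPair t P Q) (hP : P ≤ s.le 0) (hQ : Q ≤ s.ge 1) :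
    h.tilt = s := by
  refine tStructure_eq_of_le_of_ge ?_ ?_
  · rw [h.tilt_le_zero]
    exact extensionProduct_le_of_isTriangulatedClosed₂ (le_neg_one_le_of_heart_le ht hle) hP
  · rw [h.tilt_ge_one]
    exact extensionProduct_le_of_isTriangulatedClosed₂ hQ (ge_one_le_of_heart_le ht hge)

end

end TStructure

section Heart

open AbelianSubcategory

variable {C : Type*} [Category* C] [Preadditive C] [HasZeroObject C] [HasShift C ℤ]
  [∀ n : ℤ, (shiftFunctor C n).Additive] [Pretriangulated C] (t : TStructure C)
  {A : Type*} [Category* A] [Abelian A] [t.Heart A]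

lemma distinguished_of_iso₁₃ {X Y Z X' Z' : C} {f : X ⟶ Y} {g : Y ⟶ Z} {h : Z ⟶ X⟦(1 : ℤ)⟧}
    (hT : Triangle.mk f g h ∈ distTriang C) (e₁ : X' ≅ X) (e₃ : Z ≅ Z') :
    Triangle.mk (e₁.hom ≫ f) (g ≫ e₃.hom) (e₃.inv ≫ h ≫ e₁.inv⟦(1 : ℤ)⟧') ∈ distTriang C := by
  refine isomorphic_distinguished _ hT _ (Triangle.isoMk _ _ e₁ (Iso.refl Y) e₃.symm ?_ ?_ ?_)
  · exact Category.comp_id _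
  · change (g ≫ e₃.hom) ≫ e₃.inv = 𝟙 Y ≫ g
    simp
  · change (e₃.inv ≫ h ≫ e₁.inv⟦(1 : ℤ)⟧') ≫ e₁.hom⟦(1 : ℤ)⟧' = e₃.inv ≫ h
    simp

lemma exists_iso_ιHeart_obj {X : C} (hX : t.heart X) : ∃ M : A, Nonempty (X ≅ t.ιHeart.obj M) := by
  rw [← t.essImage_ιHeart A] at hX
  exact ⟨hX.witness, ⟨hX.getIso.symm⟩⟩

lemma ιHeart_hom_shift_eq_zero ⦃M N : A⦄ ⦃n : ℤ⦄
    (f : t.ιHeart.obj M ⟶ (t.ιHeart.obj N)⟦n⟧) (hn : n < 0) : f = 0 :=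
  t.zero_of_isLE_of_isGE f 0 (-n) (by lia) inferInstance
    (t.isGE_shift (t.ιHeart.obj N) 0 n (-n))

lemma admissibleMorphism_ιHeart : admissibleMorphism (t.ιHeart (H := A)) = ⊤ := by
  refine top_unique fun M N f _ X₃ f₂ f₃ hT => ?_
  have h_le : t.IsLE X₃ 0 := isLE_obj₃ t hT 0 1 rfl (inferInstanceAs (t.IsLE (t.ιHeart.obj N) 0))
    (t.isLE_of_le (t.ιHeart.obj M) 0 1)
  have h_ge : t.IsGE X₃ (-1) := t.isGE₂ _ (rot_of_distTriang _ hT) (-1)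
    (t.isGE_of_ge (t.ιHeart.obj N) (-1) 0) (t.isGE_shift (t.ιHeart.obj M) 0 1 (-1))
  obtain ⟨X, Y, hX, hY, a, b, c, hT'⟩ := t.exists_triangle X₃ (-1) 0 rfl
  have hX' : t.IsGE X (-1) := isGE_obj₁ t hT' (-2) (-1) rfl h_ge ⟨t.ge_antitone (by lia) _ hY⟩
  have hY' : t.IsLE Y 0 := isLE_obj₃ t hT' 0 1 rfl h_le ⟨t.le_monotone (by lia) _ hX⟩
  have hXheart : t.heart (X⟦(-1 : ℤ)⟧) :=
    ⟨t.le_shift (-1) (-1) 0 rfl _ hX, t.ge_shift (-1) (-1) 0 rfl _ hX'.ge⟩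
  obtain ⟨K, ⟨eK⟩⟩ := exists_iso_ιHeart_obj t (A := A) hXheart
  obtain ⟨Q, ⟨eQ⟩⟩ := exists_iso_ιHeart_obj t (A := A) ⟨hY'.le, hY⟩
  let e : (t.ιHeart.obj K)⟦(1 : ℤ)⟧ ≅ X :=
    (shiftFunctor C (1 : ℤ)).mapIso eK.symm ≪≫ shiftNegShift X (1 : ℤ)
  exact ⟨K, Q, _, _, _, distinguished_of_iso₁₃ hT' e eQ⟩

variable {t}

lemma shortExact_of_distinguished (S : ShortComplex A)
    {δ : t.ιHeart.obj S.X₃ ⟶ (t.ιHeart.obj S.X₁)⟦(1 : ℤ)⟧}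
    (hT : Triangle.mk (t.ιHeart.map S.f) (t.ιHeart.map S.g) δ ∈ distTriang C) :
    S.ShortExact :=
  have hf := isLimitKernelForkOfDistTriang (ιHeart_hom_shift_eq_zero t) S.f S.g δ hT
  have hg := isColimitCokernelCoforkOfDistTriang (ιHeart_hom_shift_eq_zero t) S.f S.g δ hT
  { exact := S.exact_of_f_is_kernel hf
    mono_f := Fork.IsLimit.mono hf
    epi_g := Cofork.IsColimit.epi hg }

lemma exists_distinguished_of_shortExact {S : ShortComplex A} (hS : S.ShortExact) :
    ∃ δ : t.ιHeart.obj S.X₃ ⟶ (t.ιHeart.obj S.X₁)⟦(1 : ℤ)⟧,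
      Triangle.mk (t.ιHeart.map S.f) (t.ιHeart.map S.g) δ ∈ distTriang C := by
  have := hS.epi_g
  have := hS.mono_f
  obtain ⟨K, i, δ, hT⟩ := exists_distinguished_triangle_of_epi (ιHeart_hom_shift_eq_zero t)
    (admissibleMorphism_ιHeart t) S.g
  let e : S.X₁ ≅ K := IsLimit.conePointUniqueUpToIso hS.fIsKernel
    (isLimitKernelForkOfDistTriang (ιHeart_hom_shift_eq_zero t) i S.g δ hT)
  have he : e.hom ≫ i = S.f :=
    IsLimit.conePointUniqueUpToIso_hom_comp hS.fIsKernel _ WalkingParallelPair.zero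
  have hT' := distinguished_of_iso₁₃ hT (t.ιHeart.mapIso e) (Iso.refl _)
  rw [Functor.mapIso_hom, ← Functor.map_comp, he, Iso.refl_hom, Category.comp_id] at hT'
  exact ⟨_, hT'⟩

instance (τ : TorsionPair A) : τ.torsion.IsClosedUnderIsomorphisms := τ.torsion_of_iso

instance (τ : TorsionPair A) : τ.torsionFree.IsClosedUnderIsomorphisms := τ.torsionFree_of_iso

namespace TorsionPair

variable {σ τ : TorsionPair A}

lemma torsion_le_of_torsionFree_le (h : σ.torsionFree ≤ τ.torsionFree) :
    τ.torsion ≤ σ.torsion := by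
  intro X hX
  obtain ⟨T, F, i, p, zero, hT, hF, hS⟩ := σ.exists_shortExact X
  have : Epi i := hS.exact.epi_f (τ.hom_eq_zero hX (h _ hF) p)
  have : Mono i := hS.mono_f
  have : IsIso i := isIso_of_mono_of_epi i
  exact σ.torsion.prop_of_iso (asIso i) hT

lemma torsionFree_le_of_torsion_le (h : σ.torsion ≤ τ.torsion) :
    τ.torsionFree ≤ σ.torsionFree := by
  intro X hX
  obtain ⟨T, F, i, p, zero, hT, hF, hS⟩ := σ.exists_shortExact X
  have : Mono p := hS.exact.mono_g (τ.hom_eq_zero (h _ hT) hX i)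
  have : Epi p := hS.epi_g
  have : IsIso p := isIso_of_mono_of_epi p
  exact σ.torsionFree.prop_of_iso (asIso p).symm hF

lemma eq_of_le_of_le (hT : σ.torsion ≤ τ.torsion) (hF : σ.torsionFree ≤ τ.torsionFree) :
    σ = τ :=
  TorsionPair.ext (hT.antisymm (torsion_le_of_torsionFree_le hF))
    (hF.antisymm (torsionFree_le_of_torsion_le hT))

end TorsionPair

lemma isHeartTorsionPair_map (τ : TorsionPair A) :
    IsHeartTorsionPair t (τ.torsion.map t.ιHeart) (τ.torsionFree.map t.ιHeart) where
  left_le_heart := fun _ ⟨M, _, ⟨e⟩⟩ => t.heart.prop_of_iso e (t.ιHeart_obj_mem M)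
  right_le_heart := fun _ ⟨M, _, ⟨e⟩⟩ => t.heart.prop_of_iso e (t.ιHeart_obj_mem M)
  le_leftOrthogonal := by
    rintro X ⟨M, hM, ⟨e⟩⟩ Y f ⟨N, hN, ⟨e'⟩⟩
    obtain ⟨g, hg⟩ := t.ιHeart.map_surjective (e.hom ≫ f ≫ e'.inv)
    rw [τ.hom_eq_zero hM hN g, Functor.map_zero] at hg
    simpa using congrArg (e.inv ≫ · ≫ e'.hom) hg.symm
  heart_le_extensionProduct X hX := by
    obtain ⟨M, ⟨e⟩⟩ := exists_iso_ιHeart_obj t (A := A) hX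
    obtain ⟨T, F, i, p, zero, hT, hF, hS⟩ := τ.exists_shortExact M
    obtain ⟨δ, hδ⟩ := exists_distinguished_of_shortExact (t := t) hS
    exact prop_of_iso _ e.symm
      ⟨_, _, _, _, _, hδ, τ.torsion.prop_map_obj t.ιHeart hT,
        τ.torsionFree.prop_map_obj t.ιHeart hF⟩

variable {P Q : ObjectProperty C} [P.IsClosedUnderIsomorphisms] [Q.IsClosedUnderIsomorphisms]

lemma IsHeartTorsionPair.exists_shortExact (h : IsHeartTorsionPair t P Q) (M : A) :
    ∃ (X Z : A) (f : X ⟶ M) (g : M ⟶ Z) (zero : f ≫ g = 0),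
      P.inverseImage t.ιHeart X ∧ Q.inverseImage t.ιHeart Z ∧
        (ShortComplex.mk f g zero).ShortExact := by
  obtain ⟨X, Y, i, p, δ, hT, hX, hY⟩ := h.heart_le_extensionProduct _ (t.ιHeart_obj_mem M)
  obtain ⟨K, ⟨eK⟩⟩ := exists_iso_ιHeart_obj t (A := A) (h.left_le_heart X hX)
  obtain ⟨L, ⟨eL⟩⟩ := exists_iso_ιHeart_obj t (A := A) (h.right_le_heart Y hY)
  obtain ⟨f, hf⟩ := t.ιHeart.map_surjective (eK.inv ≫ i)
  obtain ⟨g, hg⟩ := t.ιHeart.map_surjective (p ≫ eL.hom)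
  have hT' := distinguished_of_iso₁₃ hT eK.symm eL
  rw [Iso.symm_hom, ← hf, ← hg] at hT'
  have zero : f ≫ g = 0 := t.ιHeart.map_injective (by
    rw [Functor.map_comp, Functor.map_zero]
    exact comp_distTriang_mor_zero₁₂ _ hT')
  exact ⟨K, L, f, g, zero, P.prop_of_iso eK hX, Q.prop_of_iso eL hY,
    shortExact_of_distinguished _ hT'⟩

variable (A) in
/-- A torsion pair in the heart of `t`, transported to an abelian category `A` which is identified
with this heart. -/
def IsHeartTorsionPair.torsionPair (h : IsHeartTorsionPair t P Q) : TorsionPair A where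
  torsion := P.inverseImage t.ιHeart
  torsionFree := Q.inverseImage t.ιHeart
  torsion_of_iso := inferInstance
  torsionFree_of_iso := inferInstance
  hom_eq_zero M N hM hN f := t.ιHeart.map_injective (by
    rw [Functor.map_zero]
    exact h.le_leftOrthogonal _ hM (t.ιHeart.map f) hN)
  exists_shortExact := h.exists_shortExact

variable (A) in
/-- Tilting (the lift map) and restriction to the heart (the trace map), as mutually inverse
bijections between the torsion pairs in the heart of `t` and the t-structures which are
intermediate with respect to `t`. -/
def torsionPairEquiv [IsTriangulated C] (ht : t.bounded = ⊤) :
    TorsionPair A ≃ {s : TStructure C // t.heart ≤ s.le 1 ∧ t.heart ≤ s.ge 0} where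
  toFun τ := ⟨(isHeartTorsionPair_map τ).tilt, (isHeartTorsionPair_map τ).heart_le_tilt_le_one,
    (isHeartTorsionPair_map τ).heart_le_tilt_ge_zero⟩
  invFun s := (isHeartTorsionPair_trace ht s.2.1 s.2.2).torsionPair A
  left_inv τ := by
    have h := isHeartTorsionPair_map (t := t) τ
    refine (TorsionPair.eq_of_le_of_le (fun M hM => ?_) fun M hM => ?_).symm
    · exact ⟨t.ιHeart_obj_mem M, h.left_le_tilt_le_zero _ (τ.torsion.prop_map_obj _ hM)⟩
    · exact ⟨t.ιHeart_obj_mem M, h.right_le_tilt_ge_one _ (τ.torsionFree.prop_map_obj _ hM)⟩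
  right_inv := by
    rintro ⟨s, hle, hge⟩
    refine Subtype.ext (tilt_eq_of_le_of_le ht hle hge (isHeartTorsionPair_map _) ?_ ?_)
    · rintro X ⟨M, hM, ⟨e⟩⟩
      exact (s.le 0).prop_of_iso e hM.2
    · rintro X ⟨M, hM, ⟨e⟩⟩
      exact (s.ge 1).prop_of_iso e hM.2

lemma map_ιHeart_eq {F : C ⥤ A} (e : t.ιHeart ⋙ F ≅ 𝟭 A) (R : ObjectProperty A)
    [R.IsClosedUnderIsomorphisms] :
    R.map t.ιHeart = t.heart ⊓ R.inverseImage F := by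
  ext X
  constructor
  · rintro ⟨M, hM, ⟨eX⟩⟩
    exact ⟨t.heart.prop_of_iso eX (t.ιHeart_obj_mem M),
      R.prop_of_iso ((e.app M).symm ≪≫ F.mapIso eX) hM⟩
  · rintro ⟨hX, hFX⟩
    obtain ⟨M, ⟨eX⟩⟩ := exists_iso_ιHeart_obj t (A := A) hX
    exact ⟨M, R.prop_of_iso (F.mapIso eX ≪≫ e.app M) hFX, ⟨eX.symm⟩⟩

section

variable (F : C ⥤ A) [F.IsHomological]

lemma isIso_map_mor₂ (T : Triangle C) (hT : T ∈ distTriang C) (h₁ : IsZero (F.obj T.obj₁))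
    (h₁' : IsZero (F.obj (T.obj₁⟦(1 : ℤ)⟧))) : IsIso (F.map T.mor₂) := by
  have : Mono (F.map T.mor₂) := (F.map_distinguished_exact T hT).mono_g (h₁.eq_of_src _ _)
  have : Epi (F.map T.mor₂) :=
    (F.map_distinguished_exact _ (rot_of_distTriang T hT)).epi_f (h₁'.eq_of_tgt _ _)
  exact isIso_of_mono_of_epi _

lemma isIso_map_mor₁ (T : Triangle C) (hT : T ∈ distTriang C) (h₃ : IsZero (F.obj T.obj₃))
    (h₃' : IsZero (F.obj (T.obj₃⟦(-1 : ℤ)⟧))) : IsIso (F.map T.mor₁) := by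
  have : Epi (F.map T.mor₁) := (F.map_distinguished_exact T hT).epi_f (h₃.eq_of_tgt _ _)
  have : Mono (F.map T.mor₁) :=
    (F.map_distinguished_exact _ (inv_rot_of_distTriang T hT)).mono_g (h₃'.eq_of_src _ _)
  exact isIso_of_mono_of_epi _

variable {F} (e : t.ιHeart ⋙ F ≅ 𝟭 A) (R : ObjectProperty A) [R.IsClosedUnderIsomorphisms]

include e

lemma le_neg_one_extensionProduct_map_ιHeart (hF : ∀ X, t.le (-1) X → IsZero (F.obj X)) :
    (t.le (-1)).extensionProduct (R.map t.ιHeart) = t.le 0 ⊓ R.inverseImage F := by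
  have isIso {X Y Z : C} {f : X ⟶ Y} {g : Y ⟶ Z} {δ} (hX : t.le (-1) X)
      (hT : Triangle.mk f g δ ∈ distTriang C) : IsIso (F.map g) :=
    isIso_map_mor₂ F _ hT (hF _ hX)
      (hF _ (t.le_monotone (by lia) _ (t.le_shift (-1) 1 (-2) rfl _ hX)))
  rw [map_ιHeart_eq e]
  ext Y
  constructor
  · rintro ⟨X, Z, f, g, δ, hT, hX, hZ, hFZ⟩
    have := isIso hX hT
    exact ⟨(t.le 0).ext_of_isTriangulatedClosed₂ _ hT (t.le_monotone (by lia) _ hX) hZ.1,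
      R.prop_of_iso (asIso (F.map g)).symm hFZ⟩
  · rintro ⟨hY, hFY⟩
    obtain ⟨X, Z, f, g, δ, hT, hX, hZ⟩ := le_zero_le_extensionProduct t Y hY
    have := isIso hX hT
    exact ⟨X, Z, f, g, δ, hT, hX, hZ, R.prop_of_iso (asIso (F.map g)) hFY⟩

lemma map_ιHeart_extensionProduct_ge_one (hF : ∀ X, t.ge 1 X → IsZero (F.obj X)) :
    (R.map t.ιHeart).extensionProduct (t.ge 1) = t.ge 0 ⊓ R.inverseImage F := by
  have isIso {X Y Z : C} {f : X ⟶ Y} {g : Y ⟶ Z} {δ} (hZ : t.ge 1 Z)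
      (hT : Triangle.mk f g δ ∈ distTriang C) : IsIso (F.map f) :=
    isIso_map_mor₁ F _ hT (hF _ hZ)
      (hF _ (t.ge_antitone (by lia) _ (t.ge_shift 1 (-1) 2 rfl _ hZ)))
  rw [map_ιHeart_eq e]
  ext Y
  constructor
  · rintro ⟨X, Z, f, g, δ, hT, ⟨hX, hFX⟩, hZ⟩
    have := isIso hZ hT
    exact ⟨(t.ge 0).ext_of_isTriangulatedClosed₂ _ hT hX.2 (t.ge_antitone (by lia) _ hZ),
      R.prop_of_iso (asIso (F.map f)) hFX⟩
  · rintro ⟨hY, hFY⟩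
    obtain ⟨X, Z, f, g, δ, hT, hX, hZ⟩ := ge_zero_le_extensionProduct t Y hY
    have := isIso hZ hT
    exact ⟨X, Z, f, g, δ, hT, ⟨hX, R.prop_of_iso (asIso (F.map f)).symm hFY⟩, hZ⟩

end

end Heart

section DerivedCategory

variable (H : Type u) [Category.{v} H] [Abelian H] [HasDerivedCategory.{w} H]

/-- The canonical t-structure on the bounded derived category. -/
noncomputable abbrev tCan : TStructure (DerivedCategory.Bounded H) :=
  (DerivedCategory.TStructure.t (C := H)).onBounded

/-- The functor `Hⁱ` on the bounded derived category. -/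
noncomputable abbrev cohoFunctor (i : ℤ) : DerivedCategory.Bounded H ⥤ H :=
  DerivedCategory.Bounded.ι ⋙ DerivedCategory.homologyFunctor H i

/-- The embedding of `H` in its bounded derived category, with `stalk` as its map on objects. -/
noncomputable abbrev stalkFunctor : H ⥤ DerivedCategory.Bounded H :=
  ObjectProperty.lift _ (DerivedCategory.singleFunctor H 0) (fun M => (stalk M).property)

instance : (stalkFunctor H).Faithful where
  map_injective h := (DerivedCategory.singleFunctor H 0).map_injective
    (congrArg DerivedCategory.Bounded.ι.map h)

instance : (stalkFunctor H).Full where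
  map_surjective f := by
    obtain ⟨g, hg⟩ := (DerivedCategory.singleFunctor H 0).map_surjective
      (DerivedCategory.Bounded.ι.map f)
    exact ⟨g, DerivedCategory.Bounded.ι.map_injective hg⟩

instance : (stalkFunctor H).Additive where
  map_add := DerivedCategory.Bounded.ι.map_injective
    (DerivedCategory.singleFunctor H 0).map_add

variable {H}

lemma heart_stalk (M : H) : (tCan H).heart (stalk M) :=
  have h_le : ((DerivedCategory.singleFunctor H 0).obj M).IsLE 0 := inferInstance
  have h_ge : ((DerivedCategory.singleFunctor H 0).obj M).IsGE 0 := inferInstance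
  ⟨h_le.le, h_ge.ge⟩

lemma exists_iso_stalk {X : DerivedCategory.Bounded H} (hX : (tCan H).heart X) :
    ∃ M : H, Nonempty (stalk M ≅ X) := by
  have : X.obj.IsLE 0 := ⟨hX.1⟩
  have : X.obj.IsGE 0 := ⟨hX.2⟩
  obtain ⟨M, ⟨e⟩⟩ := X.obj.exists_iso_singleFunctor_obj_of_isGE_of_isLE 0
  exact ⟨M, ⟨ObjectProperty.isoMk _ e.symm⟩⟩

noncomputable instance : (tCan H).Heart H where
  ι := stalkFunctor H
  essImage_eq_heart := by
    ext X
    exact ⟨fun ⟨M, ⟨e⟩⟩ => (tCan H).heart.prop_of_iso e (heart_stalk M), exists_iso_stalk⟩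

variable (H) in
lemma bounded_tCan : (tCan H).bounded = ⊤ :=
  top_unique fun X _ =>
    ⟨X.property.1.imp fun n => (ObjectProperty.tStructure_isGE_iff _ _ X n).2,
      X.property.2.imp fun n => (ObjectProperty.tStructure_isLE_iff _ _ X n).2⟩

lemma le_tCan_iff (X : DerivedCategory.Bounded H) (n : ℤ) :
    (tCan H).le n X ↔ ∀ i : ℤ, n < i → IsZero (coho i X) := by
  rw [TStructure.le_iff_isLE, ObjectProperty.tStructure_isLE_iff]
  exact DerivedCategory.isLE_iff X.obj n

lemma ge_tCan_iff (X : DerivedCategory.Bounded H) (n : ℤ) :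
    (tCan H).ge n X ↔ ∀ i : ℤ, i < n → IsZero (coho i X) := by
  rw [TStructure.ge_iff_isGE, ObjectProperty.tStructure_isGE_iff]
  exact DerivedCategory.isGE_iff X.obj n

lemma liftAisle_eq (τ : TorsionPair H) :
    liftAisle τ = (tCan H).le 0 ⊓ τ.torsion.inverseImage (cohoFunctor H 0) := by
  ext X
  exact and_congr (le_tCan_iff X 0).symm Iff.rfl

lemma liftCoaisle_iff (τ : TorsionPair H) (X : DerivedCategory.Bounded H) :
    liftCoaisle τ X ↔ (tCan H).ge (-1) X ∧ τ.torsionFree (coho (-1) X) :=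
  and_congr (ge_tCan_iff X (-1)).symm Iff.rfl

/-- The isomorphism `Hⁱ(X[n]) ≅ Hⁿ⁺ⁱ(X)`. -/
noncomputable def cohoShiftIso (X : DerivedCategory.Bounded H) (n i j : ℤ) (h : n + i = j) :
    coho i (X⟦n⟧) ≅ coho j X :=
  (DerivedCategory.homologyFunctor H i).mapIso
      ((DerivedCategory.Bounded.ι.commShiftIso n).app X) ≪≫
    ((DerivedCategory.homologyFunctor H 0).shiftIso n i j h).app X.obj

variable (H) in
/-- The isomorphism `H⁰(M) ≅ M` for a stalk complex `M`. -/
noncomputable def ιHeartCompCohoFunctorIso : (tCan H).ιHeart ⋙ cohoFunctor H 0 ≅ 𝟭 H :=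
  DerivedCategory.singleFunctorCompHomologyFunctorIso H 0

lemma tilt_le_zero_eq_liftAisle (τ : TorsionPair H) :
    (isHeartTorsionPair_map (t := tCan H) τ).tilt.le 0 = liftAisle τ := by
  rw [IsHeartTorsionPair.tilt_le_zero, liftAisle_eq,
    le_neg_one_extensionProduct_map_ιHeart (ιHeartCompCohoFunctorIso H)]
  exact fun X hX => (le_tCan_iff X (-1)).1 hX 0 (by lia)

lemma tilt_ge_one_eq_inf (τ : TorsionPair H) :
    (isHeartTorsionPair_map (t := tCan H) τ).tilt.ge 1 =
      (tCan H).ge 0 ⊓ τ.torsionFree.inverseImage (cohoFunctor H 0) := by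
  rw [IsHeartTorsionPair.tilt_ge_one,
    map_ιHeart_extensionProduct_ge_one (ιHeartCompCohoFunctorIso H)]
  exact fun X hX => (ge_tCan_iff X 1).1 hX 0 (by lia)

lemma tilt_ge_zero_eq_liftCoaisle (τ : TorsionPair H) :
    (isHeartTorsionPair_map (t := tCan H) τ).tilt.ge 0 = liftCoaisle τ := by
  ext X
  rw [← TStructure.shift_ge _ (-1) 1 0 (by lia), tilt_ge_one_eq_inf, liftCoaisle_iff,
    ← (tCan H).shift_ge (-1) 0 (-1) (by lia)]
  exact and_congr Iff.rfl (τ.torsionFree.prop_iff_of_iso (cohoShiftIso X (-1) 0 (-1) rfl))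

lemma isLift_torsionPairEquiv (τ : TorsionPair H) :
    IsLift τ (torsionPairEquiv H (bounded_tCan H) τ).1 where
  le_zero_eq := tilt_le_zero_eq_liftAisle τ
  ge_zero_eq := tilt_ge_zero_eq_liftCoaisle τ

lemma isTrace_torsionPairEquiv_symm (s : {s : TStructure (DerivedCategory.Bounded H) //
    (tCan H).heart ≤ s.le 1 ∧ (tCan H).heart ≤ s.ge 0}) :
    IsTrace s.1 ((torsionPairEquiv H (bounded_tCan H)).symm s) where
  torsion_iff M := and_iff_right (heart_stalk M)
  torsionFree_iff M := by
    rw [rightOrthogonal_le s.1 0 1 rfl]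
    exact and_iff_right (heart_stalk M)

lemma heart_tCan_le_iff (R : ObjectProperty (DerivedCategory.Bounded H))
    [R.IsClosedUnderIsomorphisms] : (tCan H).heart ≤ R ↔ ∀ M : H, R (stalk M) := by
  refine ⟨fun h M => h _ (heart_stalk M), fun h X hX => ?_⟩
  obtain ⟨M, ⟨e⟩⟩ := exists_iso_stalk hX
  exact R.prop_of_iso e (h M)

lemma isIntermediate_iff (s : TStructure (DerivedCategory.Bounded H)) :
    IsIntermediate s ↔ (tCan H).heart ≤ s.le 1 ∧ (tCan H).heart ≤ s.ge 0 := by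
  rw [heart_tCan_le_iff, heart_tCan_le_iff, ← s.shift_le 1 0 1 rfl, ← s.shift_ge (-1) 1 0 rfl,
    ← rightOrthogonal_le s 0 1 rfl]
  exact ⟨fun h => ⟨h.1, h.2⟩, fun h => ⟨h.1, h.2⟩⟩

end DerivedCategory

end TorsionTilt

theorem proposition2p4_general {H : Type u} [Category.{v} H] [Abelian H]
    [HasDerivedCategory.{w} H] :
    ∃ Φ : TorsionTilt.TorsionPair H ≃
        {s : TStructure (DerivedCategory.Bounded H) // TorsionTilt.IsIntermediate s},
      (∀ τ : TorsionTilt.TorsionPair H, TorsionTilt.IsLift τ (Φ τ).1) ∧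
      (∀ s : {s : TStructure (DerivedCategory.Bounded H) // TorsionTilt.IsIntermediate s},
        TorsionTilt.IsTrace s.1 (Φ.symm s)) :=
  ⟨(TorsionTilt.torsionPairEquiv H (TorsionTilt.bounded_tCan H)).trans
      (Equiv.subtypeEquivRight fun s => (TorsionTilt.isIntermediate_iff s).symm),
    TorsionTilt.isLift_torsionPairEquiv, fun ⟨s, hs⟩ =>
      TorsionTilt.isTrace_torsionPairEquiv_symm ⟨s, (TorsionTilt.isIntermediate_iff s).1 hs⟩⟩

theorem proposition2p4 {k : Type t} [Field k] [IsAlgClosed k]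
    {H : Type u} [Category.{v} H] [Abelian H] [Linear k H]
    [HasExt.{w'} H] [HasDerivedCategory.{w} H]
    (hH : TorsionTilt.IsHereditary.{w'} k H) :
    ∃ Φ : TorsionTilt.TorsionPair H ≃
        {s : TStructure (DerivedCategory.Bounded H) // TorsionTilt.IsIntermediate s},
      (∀ τ : TorsionTilt.TorsionPair H, TorsionTilt.IsLift τ (Φ τ).1) ∧
      (∀ s : {s : TStructure (DerivedCategory.Bounded H) // TorsionTilt.IsIntermediate s},
        TorsionTilt.IsTrace s.1 (Φ.symm s)) :=
  proposition2p4_general
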